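/- Let $n\ge 2$ and let $\Omega\subset\mathbb R^n$ be a bounded domain with smooth boundary. Let $\Gamma\subseteq\mathbb R^n$ be an open convex symmetric cone with vertex at the origin, containing the positive cone $\Gamma_n=\{\lambda:\lambda_i>0\ \forall i\}$, and let $f\in C^2(\Gamma)\cap C(\overline\Gamma)$ be a symmetric function such that $\partial f/\partial\lambda_i>0$ in $\Gamma$ for $1\le i\le n$, $f$ is concave in $\Gamma$, $f>0$ in $\Gamma$ and $f=0$ on $\partial\Gamma$. Let $\psi\in C^\infty(\overline\Omega)$ with $\psi\ge 0$ in $\Omega$, let $\varphi$ be a function on $\partial\Omega$, and let $\varepsilon_0>0$, $A$, $M$, $K$ be real numbers. For a symmetric matrix $B$ let $\lambda[B]\in\mathbb R^n$ denote its eigenvalues. Then there is a constant $C>0$, depending only on $n,\Omega,\Gamma,f,\psi,\varphi,\varepsilon_0,A,M,K$ (in particular neither on $\gamma$ or $\gamma^{-1}$ nor on $\varepsilon$), such that the following holds. Let $\gamma\ge 0$ and let * $\underline u\in C^2(\overline\Omega)$ be a subsolution: $\lambda[D^2\underline u+\gamma\Delta\underline u\,I]\in\Gamma$ on $\overline\Omega$,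 $f(\lambda[D^2\underline u+\gamma\Delta\underline u\,I])\ge\psi$ in $\Omega$, $\underline u=\varphi$ on $\partial\Omega$, with $f(\lambda[D^2\underline u+\gamma\Delta\underline u\,I])\ge\varepsilon_0$ on $\overline\Omega$ and $|\underline u|_{C^2(\overline\Omega)}\le K$; * $\eta\in C^\infty[0,\infty)$ satisfy $0\le\eta\le1$, $\eta=1$ on $[0,\varepsilon_0/4]$, $\eta=0$ on $[\varepsilon_0/2,\infty)$, $|\eta'|\le A\varepsilon_0^{-1}$ and $|\eta''|\le A\varepsilon_0^{-2}$, and let $0<\varepsilon\le\varepsilon_0/2$; * $u\in C^4(\overline\Omega)$ be an admissible solution (that is, $\lambda[D^2u+\gamma\Delta u\,I]\in\overline\Gamma$ in $\Omega$) of the approximating problem $$f(\lambda[D^2u+\gamma\Delta u\,I])=\psi+\varepsilon\,\eta(\psi)\ \text{ in }\Omega,\qquad u=\varphi\ \text{ on }\partial\Omega,$$ with $|u|_{C^1(\overline\Omega)}\le M$. Then $$\sup_{\overline\Omega}|D^2u|\le C\max\{\gamma,1\}\Bigl(1+\sup_{\partial\Omega}|D^2u|\Bigr).$$ In particular, if $0\le\gamma\le1$,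 then $\sup_{\overline\Omega}|D^2u|\le C\bigl(1+\sup_{\partial\Omega}|D^2u|\bigr)$ with the same $C$. -/

import Mathlib

open Set Filter Topology
open scoped ContDiff Matrix

noncomputable section

namespace HessianEq

/-- Euclidean `n`-space. -/
abbrev E (n : ℕ) := EuclideanSpace ℝ (Fin n)

variable {n : ℕ}

/-! ### Domains and the spaces of functions smooth up to the boundary -/

/-- `∂Ω` is smooth: near every boundary point, `Ω` is the sublevel set `{ρ < 0}` of a smooth
function `ρ` without critical points. -/
def HasSmoothBoundary (Ω : Set (E n)) : Prop :=
  ∀ x ∈ frontier Ω, ∃ (V : Set (E n)) (ρ : E n → ℝ), IsOpen V ∧ x ∈ V ∧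
    ContDiffOn ℝ ∞ ρ V ∧ (∀ y ∈ V, fderiv ℝ ρ y ≠ 0) ∧ Ω ∩ V = {y ∈ V | ρ y < 0}

/-- A bounded domain (nonempty connected open set) with smooth boundary. -/
structure IsSmoothBoundedDomain (Ω : Set (E n)) : Prop where
  isOpen : IsOpen Ω
  isConnected : IsConnected Ω
  isBounded : Bornology.IsBounded Ω
  smooth_boundary : HasSmoothBoundary Ω

/-- The `j`-th derivative `Dʲ u` on `closure Ω`: the extension to `closure Ω`, by limits from
inside the open set `Ω`, of the classical derivative of `u` in `Ω`. -/
def derivBar (Ω : Set (E n)) (j : ℕ) (u : E n → ℝ) : E n → (E n) [×j]→L[ℝ] ℝ :=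
  extendFrom Ω (iteratedFDeriv ℝ j u)

/-- `u ∈ Cᵏ(closure Ω)`: `u` is `Cᵏ` in the open set `Ω`, all its derivatives of order at most `k`
have continuous extensions to `closure Ω`, and the extension of `u` is `u`. (A function on `Ω`
extends continuously to `closure Ω` iff it has a limit at every point of `closure Ω`.) -/
structure IsCkBar (k : ℕ∞) (Ω : Set (E n)) (u : E n → ℝ) : Prop where
  contDiffOn : ContDiffOn ℝ (k : WithTop ℕ∞) u Ω
  continuousOn : ContinuousOn u (closure Ω)
  exists_limit : ∀ j : ℕ, (j : ℕ∞) ≤ k → ∀ x ∈ closure Ω,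
    ∃ L, Tendsto (iteratedFDeriv ℝ j u) (𝓝[Ω] x) (𝓝 L)

/-- `sup_S |Dʲ u|` for a subset `S` of `closure Ω`. -/
def supDeriv (Ω S : Set (E n)) (j : ℕ) (u : E n → ℝ) : ℝ :=
  sSup ((fun x => ‖derivBar Ω j u x‖) '' S)

/-- The norm `|u|_{Cᵏ(closure Ω)}`, the sum of `sup |Dʲ u|` over `0 ≤ j ≤ k`. -/
def CkNorm (k : ℕ) (Ω : Set (E n)) (u : E n → ℝ) : ℝ :=
  ∑ j ∈ Finset.range (k + 1), supDeriv Ω (closure Ω) j u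

/-- The Hessian matrix `D² u` on `closure Ω`. -/
def hess (Ω : Set (E n)) (u : E n → ℝ) (x : E n) : Matrix (Fin n) (Fin n) ℝ :=
  Matrix.of fun i j =>
    derivBar Ω 2 u x ![EuclideanSpace.single i (1 : ℝ), EuclideanSpace.single j (1 : ℝ)]

/-- The matrix `D² u + γ (Δ u) I` on `closure Ω`. -/
def augHess (Ω : Set (E n)) (γ : ℝ) (u : E n → ℝ) (x : E n) : Matrix (Fin n) (Fin n) ℝ :=
  hess Ω u x + (γ * (hess Ω u x).trace) • (1 : Matrix (Fin n) (Fin n) ℝ)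

open Classical in
/-- The eigenvalues `λ[A] = (λ₁, …, λₙ)` of a real symmetric matrix `A`, with multiplicity; only
symmetric functions of them are used. (The value for a matrix that is not symmetric is junk.) -/
def eig (A : Matrix (Fin n) (Fin n) ℝ) : Fin n → ℝ :=
  if h : A.IsHermitian then h.eigenvalues else 0

/-! ### The structure conditions on the equation -/

/-- `Γ` is an open convex symmetric cone with vertex at the origin that contains the positive
cone. -/
structure IsAdmissibleCone (Γ : Set (Fin n → ℝ)) : Prop where
  isOpen : IsOpen Γ
  convex : Convex ℝ Γ
  cone : ∀ l ∈ Γ, ∀ t : ℝ, 0 < t → t • l ∈ Γ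
  symm : ∀ l ∈ Γ, ∀ σ : Equiv.Perm (Fin n), l ∘ σ ∈ Γ
  posCone_subset : {l : Fin n → ℝ | ∀ i, 0 < l i} ⊆ Γ

/-- The structure conditions: `f ∈ C²(Γ) ∩ C(closure Γ)` is symmetric, has positive partial
derivatives in `Γ`, is concave and positive in `Γ`, and vanishes on `∂Γ`. -/
structure StructureConditions (Γ : Set (Fin n → ℝ)) (f : (Fin n → ℝ) → ℝ) : Prop where
  contDiffOn : ContDiffOn ℝ 2 f Γ
  continuousOn : ContinuousOn f (closure Γ)
  symm : ∀ l ∈ closure Γ, ∀ σ : Equiv.Perm (Fin n), f (l ∘ σ) = f l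
  deriv_pos : ∀ l ∈ Γ, ∀ i, 0 < fderiv ℝ f l (Pi.single i 1)
  concave : ConcaveOn ℝ Γ f
  pos : ∀ l ∈ Γ, 0 < f l
  zero : ∀ l ∈ frontier Γ, f l = 0

/-- The subsolution condition: `u' ∈ C²(closure Ω)`, `λ[D²u' + γ Δu' I] ∈ Γ` on `closure Ω`,
`f(λ[D²u' + γ Δu' I]) ≥ ψ` in `Ω`, and `u' = φ` on `∂Ω`. -/
structure IsSubsolution (Γ : Set (Fin n → ℝ)) (f : (Fin n → ℝ) → ℝ) (Ω : Set (E n))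
    (ψ φ : E n → ℝ) (γ : ℝ) (u' : E n → ℝ) : Prop where
  c2 : IsCkBar 2 Ω u'
  mem_cone : ∀ x ∈ closure Ω, eig (augHess Ω γ u' x) ∈ Γ
  ge : ∀ x ∈ Ω, ψ x ≤ f (eig (augHess Ω γ u' x))
  boundary : ∀ x ∈ frontier Ω, u' x = φ x

/-- The cutoff functions `η ∈ C^∞[0, ∞)` of the approximating problem: `0 ≤ η ≤ 1`, `η = 1` on
`[0, ε₀/4]`, `η = 0` on `[ε₀/2, ∞)`, `|η'| ≤ A / ε₀` and `|η''| ≤ A / ε₀²`. -/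
structure IsCutoff (ε₀ A : ℝ) (η : ℝ → ℝ) : Prop where
  smooth : ContDiffOn ℝ ∞ η (Ici 0)
  eq_one : ∀ t ∈ Icc 0 (ε₀ / 4), η t = 1
  eq_zero : ∀ t ∈ Ici (ε₀ / 2), η t = 0
  mem_Icc : ∀ t ∈ Ici (0 : ℝ), η t ∈ Icc (0 : ℝ) 1
  deriv_le : ∀ t ∈ Ioi (0 : ℝ), |deriv η t| ≤ A / ε₀
  deriv2_le : ∀ t ∈ Ioi (0 : ℝ), |iteratedDeriv 2 η t| ≤ A / ε₀ ^ 2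

/-- `u` is admissible: `λ[D²u + γ Δu I] ∈ closure Γ` in `Ω`. -/
def IsAdmissible (Γ : Set (Fin n → ℝ)) (Ω : Set (E n)) (γ : ℝ) (u : E n → ℝ) : Prop :=
  ∀ x ∈ Ω, eig (augHess Ω γ u x) ∈ closure Γ

/-- `u` solves the approximating Dirichlet problem `f(λ[D²u + γ Δu I]) = ψ + ε η(ψ)` in `Ω`,
`u = φ` on `∂Ω`. -/
structure SolvesApprox (f : (Fin n → ℝ) → ℝ) (Ω : Set (E n)) (ψ φ : E n → ℝ) (η : ℝ → ℝ)
    (ε γ : ℝ) (u : E n → ℝ) : Prop where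
  eqn : ∀ x ∈ Ω, f (eig (augHess Ω γ u x)) = ψ x + ε * η (ψ x)
  boundary : ∀ x ∈ frontier Ω, u x = φ x

end HessianEq

end

/-! Maximum principle for `u_ξξ + B |x|²`, with `B` large. Suppose it has an interior maximum at
`z`, and freeze an eigenbasis `b` of the augmented Hessian at `z`. At a nearby point the diagonal
entries `d(x)` in this basis form a doubly stochastic image of the eigenvalues, so concavity and
symmetry give `f(λ(x)) ≤ f(d(x))`, and the tangent plane at `λ(z)` bounds the latter. Hence `h - ∑
F_i d_i` is maximal at `z`, where `h` is the right-hand side and `F_i = ∂f/∂λ_i` at `λ(z)`. This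
replaces differentiating `f(λ[·])` twice as a function of matrices.

Taking second derivatives along `ξ` gives `h_ξξ ≤ ∑ F_i (d_i)_ξξ ≤ -2B ∑ F_i`
(`dirDeriv_sq_le_of_isMax`); the `γ` term has a favourable sign and drops out. On the other side,
`h_ξξ` is bounded below uniformly in `ε` (`IsCutoff.le_dirDeriv_sq`), and `∑ F_i` is bounded below
because `f(t, …, t)` exceeds `h` by a fixed `δ` for some `t` (`StructureConditions.sub_le_mul_sum`).
A large `B` is therefore contradictory, and `u_ξξ` is controlled from the boundary.

The cone lies in `∑ λ_i ≥ 0`, so `Δu ≥ 0`, and the upper bounds on `u_ξξ` yield the full Hessian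
bound. The constant obtained is free of `γ` even without the factor `max γ 1`. -/

noncomputable section

namespace HessianEq

variable {n : ℕ}

/-! ### The function `f` on the cone -/

section Cone

variable {Γ : Set (Fin n → ℝ)} {f : (Fin n → ℝ) → ℝ}

/-- A matrix that is doubly stochastic maps a vector to a convex combination of its permutations. -/
lemma mulVec_mem_convexHull_perm {S : Matrix (Fin n) (Fin n) ℝ}
    (hS : S ∈ doublyStochastic ℝ (Fin n)) (l : Fin n → ℝ) :
    S *ᵥ l ∈ convexHull ℝ (range fun σ : Equiv.Perm (Fin n) => l ∘ σ) := by
  obtain ⟨w, hw0, hw1, hw⟩ := exists_eq_sum_perm_of_mem_doublyStochastic hS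
  refine mem_convexHull_of_exists_fintype w (fun σ : Equiv.Perm (Fin n) => l ∘ σ) hw0 hw1
    (fun σ => mem_range_self σ) ?_
  rw [← hw, Matrix.sum_mulVec]
  refine Finset.sum_congr rfl fun σ _ => ?_
  rw [Matrix.smul_mulVec, Matrix.permMatrix_mulVec]

lemma IsAdmissibleCone.mulVec_mem (hΓ : IsAdmissibleCone Γ) {S : Matrix (Fin n) (Fin n) ℝ}
    (hS : S ∈ doublyStochastic ℝ (Fin n)) {l : Fin n → ℝ} (hl : l ∈ Γ) : S *ᵥ l ∈ Γ :=
  convexHull_min (by rintro _ ⟨σ, rfl⟩; exact hΓ.symm l hl σ) hΓ.convex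
    (mulVec_mem_convexHull_perm hS l)

/-- Superlevel sets of the concave `f` are convex; this one contains every permutation of `l`, hence
their convex hull. -/
lemma StructureConditions.le_mulVec (hΓ : IsAdmissibleCone Γ) (hf : StructureConditions Γ f)
    {S : Matrix (Fin n) (Fin n) ℝ} (hS : S ∈ doublyStochastic ℝ (Fin n)) {l : Fin n → ℝ}
    (hl : l ∈ Γ) : f l ≤ f (S *ᵥ l) := by
  have h := convexHull_min (s := range fun σ : Equiv.Perm (Fin n) => l ∘ σ)
    (t := {m ∈ Γ | f l ≤ f m}) (by
      rintro _ ⟨σ, rfl⟩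
      exact ⟨hΓ.symm l hl σ, (hf.symm l (subset_closure hl) σ).ge⟩)
    (hf.concave.convex_ge (f l)) (mulVec_mem_convexHull_perm hS l)
  exact h.2

/-- The sum of `f_i(l) m_i` over `i`. -/
lemma fderiv_apply_eq_sum (f : (Fin n → ℝ) → ℝ) (l m : Fin n → ℝ) :
    fderiv ℝ f l m = ∑ i, m i * fderiv ℝ f l (Pi.single i 1) := by
  conv_lhs => rw [pi_eq_sum_univ' m, map_sum]
  refine Finset.sum_congr rfl fun i _ => ?_
  rw [map_smul, smul_eq_mul]

/-- The graph of `f` lies below its tangent planes. -/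
lemma StructureConditions.le_tangent (hΓ : IsAdmissibleCone Γ) (hf : StructureConditions Γ f)
    {l m : Fin n → ℝ} (hl : l ∈ Γ) (hm : m ∈ Γ) : f m ≤ f l + fderiv ℝ f l (m - l) := by
  have hd : HasFDerivAt f (fderiv ℝ f l) l :=
    ((hf.contDiffOn.contDiffAt (hΓ.isOpen.mem_nhds hl)).differentiableAt (by norm_num)).hasFDerivAt
  have hline : HasDerivAt (fun t : ℝ => f (l + t • (m - l))) (fderiv ℝ f l (m - l)) 0 :=
    hd.hasLineDerivAt (m - l)
  have hslope := hline.tendsto_slope_zero_right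
  -- By concavity each difference quotient from `l` towards `m` is at least the full increment `f m
  -- - f l`.
  have hev : ∀ᶠ t : ℝ in 𝓝[>] 0, f m - f l ≤
      t⁻¹ • (f (l + (0 + t) • (m - l)) - f (l + (0 : ℝ) • (m - l))) := by
    filter_upwards [Ioo_mem_nhdsGT (zero_lt_one' ℝ)] with t ht
    have hc := hf.concave.2 hl hm (sub_nonneg.2 ht.2.le) ht.1.le (by ring)
    have e : (1 - t) • l + t • m = l + (0 + t) • (m - l) := by
      simp only [zero_add, smul_sub, sub_smul, one_smul]; abel
    rw [e] at hc
    simp only [smul_eq_mul] at hc ⊢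
    rw [zero_smul, add_zero, le_inv_mul_iff₀ ht.1]
    linarith
  linarith [ge_of_tendsto hslope hev]

/-- If the radial derivative were negative, the tangent line along the ray through `l` would force
`f` below zero far out, against positivity. -/
lemma StructureConditions.fderiv_self_nonneg (hΓ : IsAdmissibleCone Γ)
    (hf : StructureConditions Γ f) {l : Fin n → ℝ} (hl : l ∈ Γ) : 0 ≤ fderiv ℝ f l l := by
  by_contra! h
  obtain ⟨N, hN⟩ := exists_nat_gt (f l / -fderiv ℝ f l l)
  rw [div_lt_iff₀ (by linarith)] at hN
  have hpos : (0 : ℝ) < N + 1 := by positivity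
  have hmem := hΓ.cone l hl (N + 1) hpos
  have h1 := hf.le_tangent hΓ hl hmem
  have h2 := hf.pos _ hmem
  have e : ((N : ℝ) + 1) • l - l = (N : ℝ) • l := by rw [add_smul, one_smul]; abel
  rw [e, map_smul, smul_eq_mul] at h1
  linarith

lemma StructureConditions.sum_fderiv_pos [NeZero n] (hf : StructureConditions Γ f)
    {l : Fin n → ℝ} (hl : l ∈ Γ) : 0 < ∑ i, fderiv ℝ f l (Pi.single i 1) :=
  Finset.sum_pos (fun i _ => hf.deriv_pos l hl i) Finset.univ_nonempty

lemma IsAdmissibleCone.const_mem (hΓ : IsAdmissibleCone Γ) {t : ℝ} (ht : 0 < t) :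
    (fun _ => t) ∈ Γ :=
  hΓ.posCone_subset fun _ => ht

/-- The cone lies in the half-space of vectors whose sum is nonnegative. -/
lemma StructureConditions.sum_nonneg [NeZero n] (hΓ : IsAdmissibleCone Γ)
    (hf : StructureConditions Γ f) {l : Fin n → ℝ} (hl : l ∈ Γ) : 0 ≤ ∑ i, l i := by
  have hn : (0 : ℝ) < n := Nat.cast_pos.2 (NeZero.pos n)
  -- Averaging sends `l` to a constant vector of the cone, whose radial derivative is the mean of
  -- `l` times a positive sum of partials.
  set S : Matrix (Fin n) (Fin n) ℝ := Matrix.of fun _ _ => (n : ℝ)⁻¹ with hSdef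
  have hS : S ∈ doublyStochastic ℝ (Fin n) := by
    rw [mem_doublyStochastic_iff_sum]
    refine ⟨fun i j => by simp only [hSdef, Matrix.of_apply]; positivity, fun i => ?_, fun i => ?_⟩ <;>
    · simp [hSdef, hn.ne']
  have hmem := hΓ.mulVec_mem hS hl
  have h := hf.fderiv_self_nonneg hΓ hmem
  have hs := hf.sum_fderiv_pos hmem
  have e : ∀ i, (S *ᵥ l) i = (n : ℝ)⁻¹ * ∑ j, l j := fun i => by
    simp [hSdef, Matrix.mulVec, dotProduct, Finset.mul_sum]
  rw [fderiv_apply_eq_sum] at h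
  simp only [e] at h
  rw [← Finset.mul_sum] at h
  have h3 := nonneg_of_mul_nonneg_left h hs
  exact nonneg_of_mul_nonneg_right h3 (inv_pos.2 hn)

/-- The tangent plane at `(t, …, t)` suffices: its slopes are positive and the increments `l i - t`
are not. -/
lemma StructureConditions.le_const (hΓ : IsAdmissibleCone Γ) (hf : StructureConditions Γ f)
    {l : Fin n → ℝ} (hl : l ∈ Γ) {t : ℝ} (ht : 0 < t) (hlt : ∀ i, l i ≤ t) :
    f l ≤ f fun _ => t := by
  have h := hf.le_tangent hΓ (hΓ.const_mem ht) hl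
  rw [fderiv_apply_eq_sum] at h
  simp only [Pi.sub_apply] at h
  have : ∑ i, (l i - t) * fderiv ℝ f (fun _ => t) (Pi.single i 1) ≤ 0 :=
    Finset.sum_nonpos fun i _ => mul_nonpos_of_nonpos_of_nonneg (by simpa using hlt i)
      (hf.deriv_pos _ (hΓ.const_mem ht) i).le
  linarith

lemma StructureConditions.const_lt [NeZero n] (hΓ : IsAdmissibleCone Γ)
    (hf : StructureConditions Γ f) {s t : ℝ} (hs : 0 < s) (hst : s < t) :
    f (fun _ => s) < f fun _ => t := by
  have ht := hs.trans hst
  have h := hf.le_tangent hΓ (hΓ.const_mem ht) (hΓ.const_mem hs)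
  rw [fderiv_apply_eq_sum] at h
  simp only [Pi.sub_apply] at h
  rw [← Finset.mul_sum] at h
  have := mul_pos (sub_pos.2 hst) (hf.sum_fderiv_pos (hΓ.const_mem ht))
  linarith

/-- A lower bound for the trace of the linearized operator. -/
lemma StructureConditions.sub_le_mul_sum (hΓ : IsAdmissibleCone Γ) (hf : StructureConditions Γ f)
    {l : Fin n → ℝ} (hl : l ∈ Γ) {t : ℝ} (ht : 0 < t) :
    f (fun _ => t) - f l ≤ t * ∑ i, fderiv ℝ f l (Pi.single i 1) := by
  have h := hf.le_tangent hΓ hl (hΓ.const_mem ht)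
  have h' := hf.fderiv_self_nonneg hΓ hl
  rw [map_sub, fderiv_apply_eq_sum f l (fun _ => t), ← Finset.mul_sum] at h
  linarith

/-- Upgrades admissibility, which only gives the closed cone, to the open cone where `f` is
differentiable. -/
lemma StructureConditions.mem_of_pos (hΓ : IsAdmissibleCone Γ) (hf : StructureConditions Γ f)
    {l : Fin n → ℝ} (hl : l ∈ closure Γ) (h : 0 < f l) : l ∈ Γ := by
  by_contra hn
  exact h.ne' (hf.zero l ⟨hl, by rwa [hΓ.isOpen.interior_eq]⟩)

end Cone

/-! ### Diagonal entries and eigenvalues of symmetric matrices -/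

section Diagonal

variable {A : Matrix (Fin n) (Fin n) ℝ}

/-- The quadratic form of a matrix. -/
def quadForm (A : Matrix (Fin n) (Fin n) ℝ) (v : E n) : ℝ := ∑ i, ∑ j, A i j * (v i * v j)

lemma quadForm_eq_dotProduct (A : Matrix (Fin n) (Fin n) ℝ) (v : E n) :
    quadForm A v = v.ofLp ⬝ᵥ (A *ᵥ v.ofLp) := by
  simp only [quadForm, dotProduct, Matrix.mulVec, Finset.mul_sum]
  exact Finset.sum_congr rfl fun i _ => Finset.sum_congr rfl fun j _ => by ring

lemma eig_of_isHermitian (hA : A.IsHermitian) : eig A = hA.eigenvalues := dif_pos hA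

lemma quadForm_eigenvectorBasis (hA : A.IsHermitian) (i : Fin n) :
    quadForm A (hA.eigenvectorBasis i) = eig A i := by
  rw [quadForm_eq_dotProduct, hA.mulVec_eigenvectorBasis, eig_of_isHermitian hA,
    dotProduct_smul, smul_eq_mul]
  have h := hA.eigenvectorBasis.inner_eq_one i
  rw [EuclideanSpace.inner_eq_star_dotProduct] at h
  simp only [star_trivial] at h
  rw [h, mul_one]

/-- The diagonal entries of a symmetric matrix in an orthonormal basis are obtained from its
eigenvalues by a doubly stochastic matrix. -/
lemma exists_doublyStochastic_mulVec_eig (hA : A.IsHermitian)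
    (b : OrthonormalBasis (Fin n) ℝ (E n)) :
    ∃ S ∈ doublyStochastic ℝ (Fin n), (fun i => quadForm A (b i)) = S *ᵥ eig A := by
  set c := hA.eigenvectorBasis
  -- The entries are squared coordinates of one orthonormal basis in another; Parseval in each basis
  -- gives the row and column sums.
  refine ⟨Matrix.of fun i j => (inner ℝ (c j) (b i)) ^ 2, ?_, ?_⟩
  · rw [mem_doublyStochastic_iff_sum]
    refine ⟨fun i j => sq_nonneg _, fun i => ?_, fun j => ?_⟩
    · have := c.sum_sq_norm_inner_right (b i)
      simpa using this
    · have := b.sum_sq_norm_inner_left (c j)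
      simpa using this
  · funext i
    have hb : (b i).ofLp = ∑ j, inner ℝ (c j) (b i) • (c j).ofLp := by
      conv_lhs => rw [← c.sum_repr' (b i)]
      simp
    have hAb : A *ᵥ (b i).ofLp = ∑ j, (inner ℝ (c j) (b i) * eig A j) • (c j).ofLp := by
      rw [hb, Matrix.mulVec_sum]
      refine Finset.sum_congr rfl fun j _ => ?_
      rw [Matrix.mulVec_smul, hA.mulVec_eigenvectorBasis, eig_of_isHermitian hA, smul_smul]
    rw [quadForm_eq_dotProduct, hAb, dotProduct_sum]
    simp only [Matrix.mulVec, dotProduct_smul, smul_eq_mul]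
    simp only [dotProduct, Matrix.of_apply]
    refine Finset.sum_congr rfl fun j _ => ?_
    have : inner ℝ (c j) (b i) = ∑ x, (b i).ofLp x * (c j).ofLp x := by
      rw [EuclideanSpace.inner_eq_star_dotProduct]; simp [dotProduct]
    rw [← this]
    ring

end Diagonal

/-! ### Iterated directional derivatives -/

section Directional

variable {Ω : Set (E n)} {w w' : E n → ℝ}

/-- The directional derivative of `w` in the direction `a`. -/
def dirDeriv (a : E n) (w : E n → ℝ) : E n → ℝ := fun x => fderiv ℝ w x a

lemma ContDiffOn.dirDeriv {m k : ℕ∞ω} (hw : ContDiffOn ℝ k w Ω) (hΩ : IsOpen Ω) (hmk : m + 1 ≤ k)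
    (a : E n) : ContDiffOn ℝ m (dirDeriv a w) Ω :=
  (hw.fderiv_of_isOpen hΩ hmk).clm_apply contDiffOn_const

lemma dirDeriv_congr (hΩ : IsOpen Ω) (h : EqOn w w' Ω) (a : E n) :
    EqOn (dirDeriv a w) (dirDeriv a w') Ω := fun x hx => by
  have : w =ᶠ[𝓝 x] w' := Filter.eventuallyEq_of_mem (hΩ.mem_nhds hx) h
  simp only [dirDeriv, this.fderiv_eq]

lemma dirDeriv_dirDeriv_eq (hΩ : IsOpen Ω) (hw : ContDiffOn ℝ 2 w Ω) (a b : E n) {x : E n}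
    (hx : x ∈ Ω) : dirDeriv a (dirDeriv b w) x = fderiv ℝ (fderiv ℝ w) x a b := by
  have hd : DifferentiableAt ℝ (fderiv ℝ w) x :=
    ((hw.fderiv_of_isOpen (m := 1) hΩ (by norm_num)).contDiffAt (hΩ.mem_nhds hx)).differentiableAt
      (by norm_num)
  unfold dirDeriv
  rw [fderiv_clm_apply hd (differentiableAt_const b)]
  simp

lemma dirDeriv_comm (hΩ : IsOpen Ω) (hw : ContDiffOn ℝ 2 w Ω) (a b : E n) :
    EqOn (dirDeriv a (dirDeriv b w)) (dirDeriv b (dirDeriv a w)) Ω := fun x hx => by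
  rw [dirDeriv_dirDeriv_eq hΩ hw a b hx, dirDeriv_dirDeriv_eq hΩ hw b a hx]
  exact (hw.contDiffAt (hΩ.mem_nhds hx)).isSymmSndFDerivAt (by simp) a b

/-- The second pure directional derivatives in two directions commute. -/
lemma dirDeriv_sq_comm (hΩ : IsOpen Ω) (hw : ContDiffOn ℝ 4 w Ω) (a b : E n) :
    EqOn (dirDeriv a (dirDeriv a (dirDeriv b (dirDeriv b w))))
      (dirDeriv b (dirDeriv b (dirDeriv a (dirDeriv a w)))) Ω := by
  have h2 : ContDiffOn ℝ 2 w Ω := hw.of_le (by norm_num)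
  have hb : ContDiffOn ℝ 2 (dirDeriv b w) Ω := ContDiffOn.dirDeriv hw hΩ (by norm_num) b
  have ha : ContDiffOn ℝ 2 (dirDeriv a w) Ω := ContDiffOn.dirDeriv hw hΩ (by norm_num) a
  have h3 : ContDiffOn ℝ 3 (dirDeriv a w) Ω := ContDiffOn.dirDeriv hw hΩ (by norm_num) a
  have hba : ContDiffOn ℝ 2 (dirDeriv b (dirDeriv a w)) Ω :=
    ContDiffOn.dirDeriv h3 hΩ (by norm_num) b
  exact (dirDeriv_congr hΩ (dirDeriv_comm hΩ hb a b) a).trans <|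
    (dirDeriv_congr hΩ (dirDeriv_congr hΩ (dirDeriv_comm hΩ h2 a b) b) a).trans <|
    (dirDeriv_comm hΩ hba a b).trans (dirDeriv_congr hΩ (dirDeriv_comm hΩ ha a b) b)

lemma dirDeriv_add (hΩ : IsOpen Ω) (hw : ContDiffOn ℝ 1 w Ω) (hw' : ContDiffOn ℝ 1 w' Ω)
    (a : E n) : EqOn (dirDeriv a fun x => w x + w' x)
      (fun x => dirDeriv a w x + dirDeriv a w' x) Ω := fun x hx => by
  simp only [dirDeriv]
  rw [fderiv_fun_add ((hw.contDiffAt (hΩ.mem_nhds hx)).differentiableAt (by norm_num))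
    ((hw'.contDiffAt (hΩ.mem_nhds hx)).differentiableAt (by norm_num))]
  simp

lemma dirDeriv_const_mul (hΩ : IsOpen Ω) (hw : ContDiffOn ℝ 1 w Ω) (c : ℝ)
    (a : E n) : EqOn (dirDeriv a fun x => c * w x) (fun x => c * dirDeriv a w x) Ω := fun x hx => by
  simp only [dirDeriv]
  rw [fderiv_const_mul ((hw.contDiffAt (hΩ.mem_nhds hx)).differentiableAt (by norm_num))]
  simp

lemma dirDeriv_sum (hΩ : IsOpen Ω) {ι : Type*} (s : Finset ι) {v : ι → E n → ℝ}
    (hv : ∀ i ∈ s, ContDiffOn ℝ 1 (v i) Ω) (a : E n) :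
    EqOn (dirDeriv a fun x => ∑ i ∈ s, v i x) (fun x => ∑ i ∈ s, dirDeriv a (v i) x) Ω :=
  fun x hx => by
  simp only [dirDeriv]
  rw [fderiv_fun_sum fun i hi =>
    ((hv i hi).contDiffAt (hΩ.mem_nhds hx)).differentiableAt (by norm_num)]
  simp

lemma dirDeriv_sq_add (hΩ : IsOpen Ω) (hw : ContDiffOn ℝ 2 w Ω) (hw' : ContDiffOn ℝ 2 w' Ω)
    (a : E n) : EqOn (dirDeriv a (dirDeriv a fun x => w x + w' x))
      (fun x => dirDeriv a (dirDeriv a w) x + dirDeriv a (dirDeriv a w') x) Ω :=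
  (dirDeriv_congr hΩ (dirDeriv_add hΩ (hw.of_le (by norm_num)) (hw'.of_le (by norm_num)) a) a).trans
    (dirDeriv_add hΩ (ContDiffOn.dirDeriv hw hΩ (by norm_num) a)
      (ContDiffOn.dirDeriv hw' hΩ (by norm_num) a) a)

lemma dirDeriv_sq_const_mul (hΩ : IsOpen Ω) (hw : ContDiffOn ℝ 2 w Ω) (c : ℝ) (a : E n) :
    EqOn (dirDeriv a (dirDeriv a fun x => c * w x)) (fun x => c * dirDeriv a (dirDeriv a w) x) Ω :=
  (dirDeriv_congr hΩ (dirDeriv_const_mul hΩ (hw.of_le (by norm_num)) c a) a).trans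
    (dirDeriv_const_mul hΩ (ContDiffOn.dirDeriv hw hΩ (by norm_num) a) c a)

lemma dirDeriv_sq_sum (hΩ : IsOpen Ω) {ι : Type*} (s : Finset ι) {v : ι → E n → ℝ}
    (hv : ∀ i ∈ s, ContDiffOn ℝ 2 (v i) Ω) (a : E n) :
    EqOn (dirDeriv a (dirDeriv a fun x => ∑ i ∈ s, v i x))
      (fun x => ∑ i ∈ s, dirDeriv a (dirDeriv a (v i)) x) Ω :=
  (dirDeriv_congr hΩ (dirDeriv_sum hΩ s (fun i hi => (hv i hi).of_le (by norm_num)) a) a).trans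
    (dirDeriv_sum hΩ s (fun i hi => ContDiffOn.dirDeriv (hv i hi) hΩ (by norm_num) a) a)

lemma dirDeriv_sq_norm_sq (a x : E n) :
    dirDeriv a (dirDeriv a fun y => ‖y‖ ^ 2) x = 2 * ‖a‖ ^ 2 := by
  have h : (dirDeriv a fun y : E n => ‖y‖ ^ 2) = fun y => (2 • innerSL ℝ a) y := by
    funext y
    simp only [dirDeriv, fderiv_norm_sq_apply]
    simp [real_inner_comm]
  rw [h]
  simp only [dirDeriv]
  rw [ContinuousLinearMap.fderiv]
  simp

lemma hasDerivAt_comp_line {x a : E n} {t : ℝ} (hw : DifferentiableAt ℝ w (x + t • a)) :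
    HasDerivAt (fun s : ℝ => w (x + s • a)) (dirDeriv a w (x + t • a)) t := by
  have h1 : HasDerivAt (fun s : ℝ => x + s • a) a t := by
    simpa using ((hasDerivAt_id t).smul_const a).const_add x
  exact hw.hasFDerivAt.comp_hasDerivAt t h1

lemma eventually_line_mem (hΩ : IsOpen Ω) {x : E n} (hx : x ∈ Ω) (a : E n) :
    ∀ᶠ t : ℝ in 𝓝 0, x + t • a ∈ Ω := by
  have hc : ContinuousAt (fun s : ℝ => x + s • a) 0 := by fun_prop
  exact hc.eventually (hΩ.mem_nhds (by simpa using hx))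

/-- First derivatives along a line. -/
lemma deriv_comp_line (hΩ : IsOpen Ω) (hw : ContDiffOn ℝ 1 w Ω) {x : E n} (hx : x ∈ Ω) (a : E n) :
    deriv (fun s : ℝ => w (x + s • a)) =ᶠ[𝓝 0] fun s => dirDeriv a w (x + s • a) := by
  filter_upwards [eventually_line_mem hΩ hx a] with t ht
  exact (hasDerivAt_comp_line
    ((hw.contDiffAt (hΩ.mem_nhds ht)).differentiableAt (by norm_num))).deriv

/-- Second derivatives along a line. -/
lemma deriv_deriv_comp_line (hΩ : IsOpen Ω) (hw : ContDiffOn ℝ 2 w Ω) {x : E n} (hx : x ∈ Ω)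
    (a : E n) : deriv (deriv fun s : ℝ => w (x + s • a)) 0 = dirDeriv a (dirDeriv a w) x := by
  have h1 : ContDiffOn ℝ 1 (dirDeriv a w) Ω := ContDiffOn.dirDeriv hw hΩ (by norm_num) a
  rw [(deriv_comp_line hΩ (hw.of_le (by norm_num)) hx a).deriv_eq,
    (deriv_comp_line hΩ h1 hx a).eq_of_nhds, zero_smul, add_zero]

/-- At a local maximum the second derivatives are nonpositive. -/
lemma deriv_deriv_nonpos_of_isLocalMax {g : ℝ → ℝ} {t : ℝ} (h : IsLocalMax g t)
    (hc : ContinuousAt g t) : deriv (deriv g) t ≤ 0 := by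
  by_contra! hpos
  -- A positive second derivative would make the point a local minimum as well, so `g` would be
  -- locally constant.
  have hmin := isLocalMin_of_deriv_deriv_pos hpos h.deriv_eq_zero hc
  have hconst : g =ᶠ[𝓝 t] fun _ => g t := by
    filter_upwards [h, hmin] with s h1 h2 using le_antisymm h1 h2
  have : deriv (deriv g) t = 0 := by
    rw [hconst.deriv.deriv_eq]; simp
  exact hpos.ne' this

lemma dirDeriv_sq_nonpos (hΩ : IsOpen Ω) (hw : ContDiffOn ℝ 2 w Ω) {x : E n} (hx : x ∈ Ω)
    (hmax : ∀ y ∈ Ω, w y ≤ w x) (a : E n) : dirDeriv a (dirDeriv a w) x ≤ 0 := by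
  rw [← deriv_deriv_comp_line hΩ hw hx a]
  refine deriv_deriv_nonpos_of_isLocalMax ?_ ?_
  · filter_upwards [eventually_line_mem hΩ hx a] with t ht
    simpa using hmax _ ht
  · have : DifferentiableAt ℝ w (x + (0 : ℝ) • a) := by
      rw [zero_smul, add_zero]
      exact (hw.contDiffAt (hΩ.mem_nhds hx)).differentiableAt (by norm_num)
    exact (hasDerivAt_comp_line this).continuousAt

/-- The second derivative of a composition. -/
lemma dirDeriv_sq_comp (hΩ : IsOpen Ω) (hw : ContDiffOn ℝ 2 w Ω) {x : E n} (hx : x ∈ Ω)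
    {g : ℝ → ℝ} (hg : ContDiffAt ℝ 2 g (w x)) (a : E n) :
    dirDeriv a (dirDeriv a fun y => g (w y)) x =
      iteratedDeriv 2 g (w x) * dirDeriv a w x ^ 2 +
        deriv g (w x) * dirDeriv a (dirDeriv a w) x := by
  have hwx : ContDiffAt ℝ 2 w x := hw.contDiffAt (hΩ.mem_nhds hx)
  have hev : ∀ᶠ y in 𝓝 x, ContDiffAt ℝ 2 g (w y) ∧ y ∈ Ω :=
    (hwx.continuousAt.eventually (hg.eventually (by simp))).and (hΩ.mem_nhds hx)
  have h1 : dirDeriv a (fun y => g (w y)) =ᶠ[𝓝 x] fun y => deriv g (w y) * dirDeriv a w y := by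
    filter_upwards [hev] with y hy
    have hwy := ((hw.contDiffAt (hΩ.mem_nhds hy.2)).differentiableAt (by norm_num)).hasFDerivAt
    have hgy := (hy.1.differentiableAt (by norm_num)).hasDerivAt
    have e := (hgy.comp_hasFDerivAt y hwy).fderiv
    simp only [Function.comp_def] at e
    simp [dirDeriv, e]
  have hw1 : ContDiffOn ℝ 1 (dirDeriv a w) Ω := ContDiffOn.dirDeriv hw hΩ (by norm_num) a
  have hd1 : HasDerivAt (deriv g) (iteratedDeriv 2 g (w x)) (w x) := by
    rw [iteratedDeriv_succ, iteratedDeriv_one]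
    have hd : DifferentiableAt ℝ (fun y => fderiv ℝ g y 1) (w x) :=
      ((hg.fderiv_right (m := 1) (by norm_num)).differentiableAt (by norm_num)).clm_apply
        (differentiableAt_const 1)
    simpa only [fderiv_apply_one_eq_deriv] using! hd.hasDerivAt
  have hwx' := (hwx.differentiableAt (by norm_num)).hasFDerivAt
  have hwx1 := ((hw1.contDiffAt (hΩ.mem_nhds hx)).differentiableAt (by norm_num)).hasFDerivAt
  have hprod := (hd1.comp_hasFDerivAt x hwx').mul hwx1
  change fderiv ℝ (dirDeriv a fun y => g (w y)) x a = _
  rw [h1.fderiv_eq]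
  have e := hprod.fderiv
  simp only [Function.comp_def] at e
  change fderiv ℝ (fun y => deriv g (w y) * dirDeriv a w y) x = _ at e
  rw [e]
  simp [dirDeriv]
  ring

end Directional

/-! ### Functions smooth up to the boundary -/

section UpToBoundary

variable {Ω : Set (E n)} {u : E n → ℝ} {k : ℕ∞}

lemma IsCkBar.derivBar_eq (hu : IsCkBar k Ω u) (hΩ : IsOpen Ω) {j : ℕ} (hj : (j : ℕ∞) ≤ k)
    {x : E n} (hx : x ∈ Ω) : derivBar Ω j u x = iteratedFDeriv ℝ j u x := by
  refine extendFrom_eq (subset_closure hx) ?_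
  have h := (hu.contDiffOn.contDiffAt (hΩ.mem_nhds hx)).continuousAt_iteratedFDeriv
    (k := j) (by exact_mod_cast hj)
  exact h.tendsto.mono_left nhdsWithin_le_nhds

lemma IsCkBar.continuousOn_derivBar (hu : IsCkBar k Ω u) {j : ℕ} (hj : (j : ℕ∞) ≤ k) :
    ContinuousOn (derivBar Ω j u) (closure Ω) :=
  continuousOn_extendFrom subset_rfl (hu.exists_limit j hj)

lemma IsCkBar.bddAbove_norm_derivBar (hu : IsCkBar k Ω u) (hb : Bornology.IsBounded Ω) {j : ℕ}
    (hj : (j : ℕ∞) ≤ k) : BddAbove ((fun x => ‖derivBar Ω j u x‖) '' closure Ω) :=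
  hb.isCompact_closure.bddAbove_image (hu.continuousOn_derivBar hj).norm

lemma IsCkBar.exists_norm_le (hu : IsCkBar k Ω u) (hΩ : IsOpen Ω) (hb : Bornology.IsBounded Ω)
    {j : ℕ} (hj : (j : ℕ∞) ≤ k) : ∃ N : ℝ, 0 ≤ N ∧ ∀ x ∈ Ω, ‖iteratedFDeriv ℝ j u x‖ ≤ N := by
  obtain ⟨N, hN⟩ := hu.bddAbove_norm_derivBar hb hj
  refine ⟨max N 0, le_max_right _ _, fun x hx => ?_⟩
  rw [← hu.derivBar_eq hΩ hj hx]
  exact (hN (mem_image_of_mem _ (subset_closure hx))).trans (le_max_left _ _)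

lemma abs_dirDeriv_le (a x : E n) : |dirDeriv a u x| ≤ ‖iteratedFDeriv ℝ 1 u x‖ * ‖a‖ := by
  rw [norm_iteratedFDeriv_one]
  exact (fderiv ℝ u x).le_opNorm a

lemma iteratedFDeriv_two_eq_dirDeriv (hΩ : IsOpen Ω) (hu : ContDiffOn ℝ 2 u Ω) (a b : E n)
    {x : E n} (hx : x ∈ Ω) :
    iteratedFDeriv ℝ 2 u x ![a, b] = dirDeriv a (dirDeriv b u) x := by
  rw [iteratedFDeriv_two_apply, dirDeriv_dirDeriv_eq hΩ hu a b hx]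
  rfl

lemma abs_dirDeriv_sq_le (hΩ : IsOpen Ω) (hu : ContDiffOn ℝ 2 u Ω) (a : E n) {x : E n}
    (hx : x ∈ Ω) : |dirDeriv a (dirDeriv a u) x| ≤ ‖iteratedFDeriv ℝ 2 u x‖ * ‖a‖ ^ 2 := by
  rw [← iteratedFDeriv_two_eq_dirDeriv hΩ hu a a hx]
  have := (iteratedFDeriv ℝ 2 u x).le_opNorm ![a, a]
  simpa [Fin.prod_univ_two, sq] using this

lemma hess_apply (hu : IsCkBar k Ω u) (hk : 2 ≤ k) (hΩ : IsOpen Ω) {x : E n} (hx : x ∈ Ω)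
    (i j : Fin n) : hess Ω u x i j =
      fderiv ℝ (fderiv ℝ u) x (EuclideanSpace.single i 1) (EuclideanSpace.single j 1) := by
  simp only [hess, Matrix.of_apply]
  rw [hu.derivBar_eq hΩ (by exact_mod_cast hk) hx, iteratedFDeriv_two_apply]
  rfl

lemma IsCkBar.contDiffOn_two (hu : IsCkBar k Ω u) (hk : 2 ≤ k) : ContDiffOn ℝ 2 u Ω :=
  hu.contDiffOn.of_le (WithTop.coe_le_coe.2 hk)

lemma isHermitian_augHess (hu : IsCkBar k Ω u) (hk : 2 ≤ k) (hΩ : IsOpen Ω) {x : E n}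
    (hx : x ∈ Ω) (γ : ℝ) : (augHess Ω γ u x).IsHermitian := by
  have h : (hess Ω u x).IsHermitian := by
    ext i j
    simp only [Matrix.conjTranspose_apply, star_trivial]
    rw [hess_apply hu hk hΩ hx, hess_apply hu hk hΩ hx]
    exact ((hu.contDiffOn_two hk).contDiffAt (hΩ.mem_nhds hx)).isSymmSndFDerivAt (by simp) _ _
  refine h.add ?_
  ext i j
  simp [Matrix.one_apply, eq_comm]

/-- The Laplacian. -/
def lap (u : E n → ℝ) : E n → ℝ := fun x =>
  ∑ i, dirDeriv (EuclideanSpace.single i 1) (dirDeriv (EuclideanSpace.single i 1) u) x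

lemma trace_hess (hu : IsCkBar k Ω u) (hk : 2 ≤ k) (hΩ : IsOpen Ω) {x : E n} (hx : x ∈ Ω) :
    (hess Ω u x).trace = lap u x := by
  simp only [Matrix.trace, Matrix.diag, lap]
  refine Finset.sum_congr rfl fun i _ => ?_
  rw [hess_apply hu hk hΩ hx, dirDeriv_dirDeriv_eq hΩ (hu.contDiffOn_two hk) _ _ hx]

lemma sum_smul_single (v : E n) : ∑ i, v i • EuclideanSpace.single i (1 : ℝ) = v := by
  simpa using (EuclideanSpace.basisFun (Fin n) ℝ).sum_repr v

lemma bilin_eq_sum (b : E n →L[ℝ] E n →L[ℝ] ℝ) (v w : E n) : b v w =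
    ∑ i, ∑ j, b (EuclideanSpace.single i 1) (EuclideanSpace.single j 1) * (v i * w j) := by
  conv_lhs => rw [← sum_smul_single v, ← sum_smul_single w]
  simp only [map_sum, map_smul, _root_.sum_apply, _root_.smul_apply,
    smul_eq_mul]
  rw [Finset.sum_comm]
  refine Finset.sum_congr rfl fun i _ => ?_
  rw [Finset.mul_sum]
  exact Finset.sum_congr rfl fun j _ => by ring

/-- Expresses diagonal entries in a fixed orthonormal basis through derivatives of `u`, which can be
differentiated again. -/
lemma quadForm_augHess (hu : IsCkBar k Ω u) (hk : 2 ≤ k) (hΩ : IsOpen Ω) {x : E n} (hx : x ∈ Ω)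
    (γ : ℝ) {v : E n} (hv : ‖v‖ = 1) :
    quadForm (augHess Ω γ u x) v = dirDeriv v (dirDeriv v u) x + γ * lap u x := by
  rw [dirDeriv_dirDeriv_eq hΩ (hu.contDiffOn_two hk) _ _ hx, bilin_eq_sum]
  simp only [quadForm, augHess, trace_hess hu hk hΩ hx, Matrix.add_apply, Matrix.smul_apply,
    hess_apply hu hk hΩ hx, add_mul, Finset.sum_add_distrib, smul_eq_mul]
  congr 1
  have h1 : ∑ i, v i * v i = 1 := by
    have := EuclideanSpace.real_norm_sq_eq v
    rw [hv] at this
    simp only [← sq, ← this, one_pow]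
  simp only [Matrix.one_apply, mul_ite, ite_mul, mul_one, mul_zero, zero_mul,
    Finset.sum_ite_eq, Finset.mem_univ, if_true]
  rw [← Finset.mul_sum, h1, mul_one]

lemma sum_eig_augHess (hu : IsCkBar k Ω u) (hk : 2 ≤ k) (hΩ : IsOpen Ω) {x : E n} (hx : x ∈ Ω)
    (γ : ℝ) : ∑ i, eig (augHess Ω γ u x) i = (1 + γ * n) * lap u x := by
  have hA := isHermitian_augHess hu hk hΩ hx γ
  have h := hA.trace_eq_sum_eigenvalues
  rw [eig_of_isHermitian hA]
  simp only [RCLike.ofReal_real_eq_id, id] at h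
  rw [← h, augHess, Matrix.trace_add, Matrix.trace_smul, trace_hess hu hk hΩ hx]
  simp
  ring

/-- An eigenvalue is the quadratic form at a unit eigenvector, hence a pure second derivative plus
the Laplacian term. -/
lemma eig_augHess_le (hu : IsCkBar k Ω u) (hk : 2 ≤ k) (hΩ : IsOpen Ω) {x : E n} (hx : x ∈ Ω)
    {γ : ℝ} (hγ : 0 ≤ γ) {N : ℝ} (hN : ‖iteratedFDeriv ℝ 2 u x‖ ≤ N) (i : Fin n) :
    eig (augHess Ω γ u x) i ≤ N + γ * (n * N) := by
  have hA := isHermitian_augHess hu hk hΩ hx γ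
  have hbd : ∀ v : E n, ‖v‖ = 1 → dirDeriv v (dirDeriv v u) x ≤ N := fun v hv => by
    have := (le_abs_self _).trans (abs_dirDeriv_sq_le hΩ (hu.contDiffOn_two hk) v hx)
    rw [hv, one_pow, mul_one] at this
    exact this.trans hN
  rw [← quadForm_eigenvectorBasis hA,
    quadForm_augHess hu hk hΩ hx γ (hA.eigenvectorBasis.orthonormal.1 i)]
  refine add_le_add (hbd _ (hA.eigenvectorBasis.orthonormal.1 i))
    (mul_le_mul_of_nonneg_left ?_ hγ)
  calc lap u x ≤ ∑ _i : Fin n, N := Finset.sum_le_sum fun j _ => hbd _ (by simp)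
    _ = n * N := by simp

/-- Upper bounds on the pure second derivatives of a function with nonnegative Laplacian control
its Hessian. -/
lemma norm_iteratedFDeriv_two_le (hΩ : IsOpen Ω) (hu : ContDiffOn ℝ 2 u Ω) {x : E n} (hx : x ∈ Ω)
    {L : ℝ} (hL : 0 ≤ L) (hle : ∀ a : E n, ‖a‖ ≤ 2 → dirDeriv a (dirDeriv a u) x ≤ L)
    (hlap : 0 ≤ lap u x) : ‖iteratedFDeriv ℝ 2 u x‖ ≤ n ^ 2 * (n + 1) * L := by
  set b := fderiv ℝ (fderiv ℝ u) x with hbdef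
  set e : Fin n → E n := fun i => EuclideanSpace.single i (1 : ℝ) with hedef
  have he : ∀ i, ‖e i‖ = 1 := fun i => by simp [hedef]
  have hsymm : ∀ v w, b v w = b w v := fun v w =>
    (hu.contDiffAt (hΩ.mem_nhds hx)).isSymmSndFDerivAt (by simp) v w
  have hb : ∀ a, ‖a‖ ≤ 2 → b a a ≤ L := fun a ha => by
    rw [← dirDeriv_dirDeriv_eq hΩ hu a a hx]; exact hle a ha
  have hup : ∀ i, b (e i) (e i) ≤ L := fun i => hb _ (by rw [he]; norm_num)
  have hsum : 0 ≤ ∑ i, b (e i) (e i) := by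
    refine hlap.trans_eq (Finset.sum_congr rfl fun i _ => ?_)
    rw [dirDeriv_dirDeriv_eq hΩ hu _ _ hx]
  -- A nonnegative trace turns upper bounds on the other diagonal entries into a lower bound on this
  -- one.
  have hlow : ∀ i, -(n * L) ≤ b (e i) (e i) := fun i => by
    rw [← Finset.add_sum_erase _ _ (Finset.mem_univ i)] at hsum
    have h1 : ∑ j ∈ Finset.univ.erase i, b (e j) (e j) ≤ ∑ _j ∈ Finset.univ.erase i, L :=
      Finset.sum_le_sum fun j _ => hup j
    have h2 : ∑ _j ∈ Finset.univ.erase i, L ≤ ∑ _j : Fin n, L :=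
      Finset.sum_le_sum_of_subset_of_nonneg (Finset.erase_subset _ _) fun _ _ _ => hL
    simp only [Finset.sum_const, Finset.card_univ, Fintype.card_fin, nsmul_eq_mul] at h1 h2
    linarith
  -- Polarization with `e i ± e j`; this is why directions of norm up to 2 are allowed.
  have hentry : ∀ i j, |b (e i) (e j)| ≤ (n + 1) * L := fun i j => by
    have h1 := hb (e i + e j) ((norm_add_le _ _).trans (by rw [he, he]; norm_num))
    have h2 := hb (e i - e j) ((norm_sub_le _ _).trans (by rw [he, he]; norm_num))
    simp only [map_add, map_sub, _root_.add_apply, _root_.sub_apply,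
      hsymm (e j) (e i)] at h1 h2
    have := hlow i
    have := hlow j
    rw [abs_le]
    constructor <;> linarith
  refine ContinuousMultilinearMap.opNorm_le_bound (by positivity) fun m => ?_
  rw [iteratedFDeriv_two_apply, Fin.prod_univ_two, bilin_eq_sum, Real.norm_eq_abs]
  have hterm : ∀ i j, |b (e i) (e j) * (m 0 i * m 1 j)| ≤ (n + 1) * L * (‖m 0‖ * ‖m 1‖) :=
    fun i j => by
    rw [abs_mul, abs_mul]
    have h0 := PiLp.norm_apply_le (m 0) i
    have h1 := PiLp.norm_apply_le (m 1) j
    rw [Real.norm_eq_abs] at h0 h1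
    have := hentry i j
    gcongr
  calc |∑ i, ∑ j, b (e i) (e j) * (m 0 i * m 1 j)|
      ≤ ∑ i, ∑ j, |b (e i) (e j) * (m 0 i * m 1 j)| :=
        (Finset.abs_sum_le_sum_abs _ _).trans
          (Finset.sum_le_sum fun i _ => Finset.abs_sum_le_sum_abs _ _)
    _ ≤ ∑ _i : Fin n, ∑ _j : Fin n, (n + 1) * L * (‖m 0‖ * ‖m 1‖) :=
        Finset.sum_le_sum fun i _ => Finset.sum_le_sum fun j _ => hterm i j
    _ = n ^ 2 * (n + 1) * L * (‖m 0‖ * ‖m 1‖) := by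
        simp only [Finset.sum_const, Finset.card_univ, Fintype.card_fin, nsmul_eq_mul]
        ring

end UpToBoundary

/-! ### The right-hand side of the approximating problem -/

section RightHandSide

variable {Ω : Set (E n)} {ψ : E n → ℝ} {η : ℝ → ℝ} {ε₀ A ε : ℝ}

lemma IsCutoff.contDiffOn_comp (hη : IsCutoff ε₀ A η) (hψ : ContDiffOn ℝ 2 ψ Ω)
    (hψ0 : ∀ x ∈ Ω, 0 ≤ ψ x) : ContDiffOn ℝ 2 (fun x => η (ψ x)) Ω :=
  (hη.smooth.of_le (WithTop.coe_le_coe.2 le_top)).comp hψ fun x hx => hψ0 x hx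

lemma IsCutoff.add_mul_le (hη : IsCutoff ε₀ A η) (hε : 0 < ε) (hε' : ε ≤ ε₀ / 2)
    {t : ℝ} (ht : 0 ≤ t) : t + ε * η t ≤ max t ε₀ := by
  rcases le_total (ε₀ / 2) t with h | h
  · rw [hη.eq_zero t h, mul_zero, add_zero]
    exact le_max_left _ _
  · have h1 := (hη.mem_Icc t ht).2
    have : ε * η t ≤ ε * 1 := mul_le_mul_of_nonneg_left h1 hε.le
    exact le_trans (by linarith) (le_max_right _ _)

/-- The perturbation removes the degeneracy: where `ψ` vanishes, the cutoff equals 1. -/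
lemma IsCutoff.add_mul_pos (hη : IsCutoff ε₀ A η) (hε₀ : 0 < ε₀) (hε : 0 < ε)
    {t : ℝ} (ht : 0 ≤ t) : 0 < t + ε * η t := by
  rcases ht.eq_or_lt with rfl | h
  · rw [hη.eq_one 0 ⟨le_rfl, by positivity⟩]
    linarith
  · have := mul_nonneg hε.le (hη.mem_Icc t ht).1
    linarith

/-- The second derivatives of the right-hand side are bounded below, uniformly in `ε`. -/
lemma IsCutoff.le_dirDeriv_sq (hη : IsCutoff ε₀ A η) (hΩ : IsOpen Ω) (hψ : ContDiffOn ℝ 2 ψ Ω)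
    (hψ0 : ∀ x ∈ Ω, 0 ≤ ψ x) (hε₀ : 0 < ε₀) (hε : 0 < ε) (hε' : ε ≤ ε₀ / 2) {a x : E n}
    (hx : x ∈ Ω) {P Q : ℝ} (hP : |dirDeriv a ψ x| ≤ P) (hQ : |dirDeriv a (dirDeriv a ψ) x| ≤ Q) :
    -(Q + |A| / ε₀ * P ^ 2 + |A| * Q) ≤
      dirDeriv a (dirDeriv a fun y => ψ y + ε * η (ψ y)) x := by
  have hP0 : 0 ≤ P := (abs_nonneg _).trans hP
  have hQ0 : 0 ≤ Q := (abs_nonneg _).trans hQ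
  have hc := hη.contDiffOn_comp hψ hψ0
  rcases (hψ0 x hx).eq_or_lt with h0 | hpos
  -- At a zero of `ψ` the chain rule is unavailable, as `η` is smooth only on `[0, ∞)`; but nearby
  -- `η ∘ ψ = 1`.
  · have hopen : IsOpen (Ω ∩ ψ ⁻¹' Iio (ε₀ / 4)) := hψ.continuousOn.isOpen_inter_preimage hΩ isOpen_Iio
    have heq : EqOn (fun y => ψ y + ε * η (ψ y)) (fun y => ψ y + ε) (Ω ∩ ψ ⁻¹' Iio (ε₀ / 4)) := by
      intro y hy
      simp only
      rw [hη.eq_one (ψ y) ⟨hψ0 y hy.1, (show ψ y < ε₀ / 4 from hy.2).le⟩, mul_one]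
    rw [dirDeriv_congr hopen (dirDeriv_congr hopen heq a) a
      ⟨hx, show ψ x < ε₀ / 4 by rw [← h0]; positivity⟩]
    have e : dirDeriv a (fun y => ψ y + ε) = dirDeriv a ψ := by
      funext y
      simp only [dirDeriv, fderiv_add_const]
    rw [e]
    have h1 := (abs_le.1 hQ).1
    have : 0 ≤ |A| / ε₀ * P ^ 2 + |A| * Q := by positivity
    linarith
  · have hηx : ContDiffAt ℝ 2 η (ψ x) :=
      (hη.smooth.contDiffAt (Ici_mem_nhds hpos)).of_le (WithTop.coe_le_coe.2 le_top)
    have e1 := dirDeriv_sq_add hΩ hψ (contDiffOn_const.mul hc : ContDiffOn ℝ 2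
      (fun y => ε * η (ψ y)) Ω) a hx
    have e2 := dirDeriv_sq_const_mul hΩ hc ε a hx
    have e3 := dirDeriv_sq_comp hΩ hψ hx hηx a
    simp only at e1 e2
    rw [e1, e2, e3]
    have hd1 : |deriv η (ψ x)| ≤ |A| / ε₀ :=
      (hη.deriv_le _ hpos).trans (by gcongr; exact le_abs_self A)
    have hd2 : |iteratedDeriv 2 η (ψ x)| ≤ |A| / ε₀ ^ 2 :=
      (hη.deriv2_le _ hpos).trans (by gcongr; exact le_abs_self A)
    have h1 : |iteratedDeriv 2 η (ψ x) * dirDeriv a ψ x ^ 2| ≤ |A| / ε₀ ^ 2 * P ^ 2 := by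
      rw [abs_mul, abs_pow]
      gcongr
    have h2 : |deriv η (ψ x) * dirDeriv a (dirDeriv a ψ) x| ≤ |A| / ε₀ * Q := by
      rw [abs_mul]
      gcongr
    have h3 : -(|A| / ε₀ ^ 2 * P ^ 2 + |A| / ε₀ * Q) ≤ iteratedDeriv 2 η (ψ x) * dirDeriv a ψ x ^ 2 +
        deriv η (ψ x) * dirDeriv a (dirDeriv a ψ) x := by
      have := (abs_le.1 h1).1
      have := (abs_le.1 h2).1
      linarith
    have h4 := mul_le_mul_of_nonneg_left h3 hε.le
    -- The factor `ε ≤ ε₀` absorbs one power of `1 / ε₀`, making the bound independent of `ε`.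
    have h5 : ε * (|A| / ε₀ ^ 2 * P ^ 2 + |A| / ε₀ * Q) ≤
        ε₀ * (|A| / ε₀ ^ 2 * P ^ 2 + |A| / ε₀ * Q) := by
      gcongr
      linarith
    have h6 : ε₀ * (|A| / ε₀ ^ 2 * P ^ 2 + |A| / ε₀ * Q) = |A| / ε₀ * P ^ 2 + |A| * Q := by
      field_simp
    have h7 := (abs_le.1 hQ).1
    linarith

end RightHandSide

/-! ### The second derivative estimate -/

section Estimate

variable {Ω : Set (E n)} {Γ : Set (Fin n → ℝ)} {f : (Fin n → ℝ) → ℝ}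

/-- If there is a subsolution, then `f` exceeds `max ψ ε₀` by a fixed amount at some multiple of
`(1, …, 1)`. -/
lemma IsSubsolution.exists_const_ge [NeZero n] (hΩ : IsSmoothBoundedDomain Ω)
    (hΓ : IsAdmissibleCone Γ) (hf : StructureConditions Γ f) {ψ φ usub : E n → ℝ} {γ ε₀ : ℝ}
    (hγ : 0 ≤ γ) (hu : IsSubsolution Γ f Ω ψ φ γ usub)
    (hε₀ : ∀ x ∈ closure Ω, ε₀ ≤ f (eig (augHess Ω γ usub x))) :
    ∃ t : ℝ, 0 < t ∧ ∃ δ : ℝ, 0 < δ ∧ ∀ x ∈ Ω, max (ψ x) ε₀ + δ ≤ f fun _ => t := by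
  obtain ⟨N, hN0, hN⟩ := hu.c2.exists_norm_le hΩ.isOpen hΩ.isBounded (j := 2) (by norm_num)
  -- `s` exceeds every eigenvalue for the subsolution; `δ` is the strict increase of `f` from `(s,
  -- …, s)` to `(s + 1, …, s + 1)`.
  set s : ℝ := N + γ * (n * N) + 1 with hs
  have hspos : 0 < s := by positivity
  refine ⟨s + 1, by linarith, (f fun _ => s + 1) - f fun _ => s,
    sub_pos.2 (hf.const_lt hΓ hspos (by linarith)), fun x hx => ?_⟩
  have h := hf.le_const hΓ (hu.mem_cone x (subset_closure hx)) hspos fun i =>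
    (eig_augHess_le hu.c2 le_rfl hΩ.isOpen hx hγ (hN x hx) i).trans (by linarith)
  have := max_le (hu.ge x hx) (hε₀ x (subset_closure hx))
  linarith

/-- The linearized inequality at an interior maximum of `u_ξξ + B |x|²`. -/
lemma dirDeriv_sq_le_of_isMax (hΩ : IsOpen Ω) (hΓ : IsAdmissibleCone Γ)
    (hf : StructureConditions Γ f) {γ : ℝ} (hγ : 0 ≤ γ) {u h : E n → ℝ} (hu : IsCkBar 4 Ω u)
    (hh : ContDiffOn ℝ 2 h Ω) (hmem : ∀ x ∈ Ω, eig (augHess Ω γ u x) ∈ Γ)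
    (heqn : ∀ x ∈ Ω, f (eig (augHess Ω γ u x)) = h x) {B : ℝ} (hB : 0 ≤ B) (ξ : E n) {z : E n}
    (hz : z ∈ Ω) (hmax : ∀ x ∈ Ω, dirDeriv ξ (dirDeriv ξ u) x + B * ‖x‖ ^ 2 ≤
      dirDeriv ξ (dirDeriv ξ u) z + B * ‖z‖ ^ 2) :
    dirDeriv ξ (dirDeriv ξ h) z ≤
      -(2 * B) * ∑ i, fderiv ℝ f (eig (augHess Ω γ u z)) (Pi.single i 1) := by
  have hk : (2 : ℕ∞) ≤ 4 := by norm_num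
  have hu4 : ContDiffOn ℝ 4 u Ω := hu.contDiffOn
  have hu3 : ∀ a, ContDiffOn ℝ 3 (dirDeriv a u) Ω := fun a =>
    ContDiffOn.dirDeriv hu4 hΩ (by norm_num) a
  have hu2 : ∀ a, ContDiffOn ℝ 2 (dirDeriv a (dirDeriv a u)) Ω := fun a =>
    ContDiffOn.dirDeriv (hu3 a) hΩ (by norm_num) a
  have hA : ∀ x ∈ Ω, (augHess Ω γ u x).IsHermitian := fun x hx =>
    isHermitian_augHess hu hk hΩ hx γ
  set l := eig (augHess Ω γ u z) with hl
  set F : Fin n → ℝ := fun i => fderiv ℝ f l (Pi.single i 1) with hF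
  -- The basis stays fixed as `x` varies, so repeated eigenvalues cause no loss of smoothness.
  set b := (hA z hz).eigenvectorBasis with hb
  have hb1 : ∀ i, ‖b i‖ = 1 := fun i => b.orthonormal.1 i
  -- the diagonal entries of the augmented Hessian in the eigenbasis at `z`
  set d : Fin n → E n → ℝ := fun i x => dirDeriv (b i) (dirDeriv (b i) u) x + γ * lap u x with hd
  have hlap : ContDiffOn ℝ 2 (lap u) Ω := ContDiffOn.sum fun i _ => hu2 _
  have hγlap : ContDiffOn ℝ 2 (fun x => γ * lap u x) Ω := contDiffOn_const.mul hlap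
  have hd2 : ∀ i, ContDiffOn ℝ 2 (d i) Ω := fun i => (hu2 _).add hγlap
  have hFd : ∀ i, ContDiffOn ℝ 2 (fun x => -F i * d i x) Ω := fun i => contDiffOn_const.mul (hd2 i)
  have hquad : ∀ x ∈ Ω, ∀ i, quadForm (augHess Ω γ u x) (b i) = d i x := fun x hx i =>
    quadForm_augHess hu hk hΩ hx γ (hb1 i)
  have hdz : ∀ i, d i z = l i := fun i => by
    rw [← hquad z hz i, hl, hb, quadForm_eigenvectorBasis]
  -- Doubly stochastic comparison at `x`, then the tangent plane at `l`; equality holds at `z`,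
  -- where `d` is the eigenvalue vector.
  have hconc : ∀ x ∈ Ω, h x + ∑ i, -F i * d i x ≤ h z + ∑ i, -F i * d i z := fun x hx => by
    obtain ⟨S, hS, hSe⟩ := exists_doublyStochastic_mulVec_eig (hA x hx) b
    have h1 := hf.le_mulVec hΓ hS (hmem x hx)
    have h2 := hf.le_tangent hΓ (hmem z hz) (hΓ.mulVec_mem hS (hmem x hx))
    rw [← hSe] at h1 h2
    rw [heqn x hx] at h1
    rw [heqn z hz, fderiv_apply_eq_sum] at h2
    have h3 := h1.trans h2
    have e : ∑ i, ((fun i => quadForm (augHess Ω γ u x) (b i)) - eig (augHess Ω γ u z)) i *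
        fderiv ℝ f (eig (augHess Ω γ u z)) (Pi.single i 1) =
        ∑ i, -F i * d i z - ∑ i, -F i * d i x := by
      rw [← Finset.sum_sub_distrib]
      refine Finset.sum_congr rfl fun i _ => ?_
      rw [Pi.sub_apply, hquad x hx, hdz i]
      simp only [hF, hl]
      ring
    rw [e] at h3
    linarith
  have hsecond := dirDeriv_sq_nonpos hΩ (hh.add (ContDiffOn.sum fun i _ => hFd i)) hz
    (by simpa using hconc) ξ
  have e1 := dirDeriv_sq_add hΩ hh (ContDiffOn.sum (s := Finset.univ) fun i _ => hFd i) ξ hz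
  have e2 := dirDeriv_sq_sum hΩ Finset.univ (fun i _ => hFd i) ξ hz
  -- second derivatives of the diagonal entries
  have hg : ∀ a : E n, dirDeriv ξ (dirDeriv ξ (dirDeriv a (dirDeriv a u))) z ≤
      -(2 * B) * ‖a‖ ^ 2 := fun a => by
    -- After swapping the order, this is the second derivative test along `a` for the maximal
    -- function.
    rw [dirDeriv_sq_comm hΩ hu4 ξ a hz]
    have hsq : ContDiffOn ℝ 2 (fun x : E n => ‖x‖ ^ 2) Ω := (contDiff_norm_sq ℝ).contDiffOn
    have h1 := dirDeriv_sq_nonpos hΩ ((hu2 ξ).add (contDiffOn_const.mul hsq)) hz hmax a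
    have h2 := dirDeriv_sq_add hΩ (hu2 ξ) (contDiffOn_const.mul hsq : ContDiffOn ℝ 2
      (fun x : E n => B * ‖x‖ ^ 2) Ω) a hz
    have h3 := dirDeriv_sq_const_mul hΩ hsq B a hz
    simp only [dirDeriv_sq_norm_sq] at h3
    simp only [h3] at h2
    have h4 := h2.symm.trans_le h1
    linarith
  have hdd : ∀ i, dirDeriv ξ (dirDeriv ξ (d i)) z ≤ -(2 * B) := fun i => by
    have h1 := dirDeriv_sq_add hΩ (hu2 (b i)) hγlap ξ hz
    have h2 := dirDeriv_sq_const_mul hΩ hlap γ ξ hz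
    have h3 := dirDeriv_sq_sum hΩ Finset.univ
      (fun i _ => hu2 (EuclideanSpace.single i (1 : ℝ))) ξ hz
    simp only at h1 h2 h3
    -- The Laplacian part is nonpositive, so since `γ ≥ 0` it can be discarded whatever the size of
    -- `γ`.
    have h4 : dirDeriv ξ (dirDeriv ξ (lap u)) z ≤ 0 := by
      refine h3.trans_le (Finset.sum_nonpos fun j _ => (hg _).trans ?_)
      have : 0 ≤ B * ‖EuclideanSpace.single j (1 : ℝ)‖ ^ 2 := by positivity
      linarith
    have h5 := hg (b i)
    rw [hb1, one_pow, mul_one] at h5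
    have h6 := mul_nonpos_of_nonneg_of_nonpos hγ h4
    have h7 : dirDeriv ξ (dirDeriv ξ (d i)) z = _ := h1
    rw [h7, h2]
    linarith
  have hterm : ∀ i, F i * (2 * B) ≤ dirDeriv ξ (dirDeriv ξ fun x => -F i * d i x) z := fun i => by
    have h1 := dirDeriv_sq_const_mul hΩ (hd2 i) (-F i) ξ hz
    simp only at h1
    rw [h1]
    have h2 := mul_le_mul_of_nonneg_left (hdd i) (hf.deriv_pos l (hmem z hz) i).le
    simp only [hF]
    linarith
  have hsum := Finset.sum_le_sum fun i (_ : i ∈ Finset.univ) => hterm i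
  rw [← Finset.sum_mul] at hsum
  simp only [e2] at e1
  have h8 := e1.symm.trans_le hsecond
  simp only [hF] at hsum h8
  linarith

end Estimate

/-! ### Reduction to the boundary and passage to the closure -/

section GlobalEstimate

variable {Ω : Set (E n)} {Γ : Set (Fin n → ℝ)} {f : (Fin n → ℝ) → ℝ}

/-- The maximum principle for the pure second derivatives: if `u_ξξ + B |x|²` has no interior
maximum, it is bounded by its values on the boundary. -/
lemma dirDeriv_sq_le_of_no_isMax (hΩ : IsSmoothBoundedDomain Ω) {u : E n → ℝ}
    (hu : IsCkBar 4 Ω u) {B R : ℝ} (hB : 0 ≤ B) (hR : ∀ x ∈ closure Ω, ‖x‖ ≤ R) {ξ : E n}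
    (hξ : ‖ξ‖ ≤ 2) (hno : ∀ z ∈ Ω, ¬ ∀ x ∈ Ω, dirDeriv ξ (dirDeriv ξ u) x + B * ‖x‖ ^ 2 ≤
      dirDeriv ξ (dirDeriv ξ u) z + B * ‖z‖ ^ 2) {x : E n} (hx : x ∈ Ω) :
    dirDeriv ξ (dirDeriv ξ u) x ≤ 4 * supDeriv Ω (frontier Ω) 2 u + B * R ^ 2 := by
  have hk : ((2 : ℕ) : ℕ∞) ≤ 4 := by norm_num
  have hu2 : ContDiffOn ℝ 2 u Ω := hu.contDiffOn_two hk
  set G : E n → ℝ := fun y => derivBar Ω 2 u y ![ξ, ξ] + B * ‖y‖ ^ 2 with hG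
  have hGΩ : ∀ y ∈ Ω, G y = dirDeriv ξ (dirDeriv ξ u) y + B * ‖y‖ ^ 2 := fun y hy => by
    simp only [hG]
    rw [hu.derivBar_eq hΩ.isOpen hk hy, iteratedFDeriv_two_eq_dirDeriv hΩ.isOpen hu2 ξ ξ hy]
  have hGc : ContinuousOn G (closure Ω) := by
    have h1 := hu.continuousOn_derivBar hk
    have h2 : Continuous fun T : (E n) [×2]→L[ℝ] ℝ => T ![ξ, ξ] :=
      continuous_eval_const _
    exact (h2.comp_continuousOn h1).add (by fun_prop)
  obtain ⟨z, hz, hzmax⟩ := hΩ.isBounded.isCompact_closure.exists_isMaxOn ⟨x, subset_closure hx⟩ hGc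
  have hzΩ : z ∉ Ω := fun hzΩ => hno z hzΩ fun y hy => by
    rw [← hGΩ y hy, ← hGΩ z hzΩ]
    exact hzmax (subset_closure hy)
  have hzf : z ∈ frontier Ω := ⟨hz, by rwa [hΩ.isOpen.interior_eq]⟩
  have hle : G x ≤ G z := hzmax (subset_closure hx)
  have hS : ‖derivBar Ω 2 u z‖ ≤ supDeriv Ω (frontier Ω) 2 u :=
    le_csSup ((hu.bddAbove_norm_derivBar hΩ.isBounded hk).mono
      (image_mono frontier_subset_closure)) (mem_image_of_mem _ hzf)
  -- The factor 4 is `‖ξ‖ ^ 2` for `‖ξ‖ ≤ 2`.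
  have h1 : derivBar Ω 2 u z ![ξ, ξ] ≤ 4 * supDeriv Ω (frontier Ω) 2 u := by
    have h := (derivBar Ω 2 u z).le_opNorm ![ξ, ξ]
    simp only [Fin.prod_univ_two, Matrix.cons_val_zero, Matrix.cons_val_one] at h
    calc derivBar Ω 2 u z ![ξ, ξ] ≤ ‖derivBar Ω 2 u z‖ * (‖ξ‖ * ‖ξ‖) := (le_abs_self _).trans h
      _ ≤ supDeriv Ω (frontier Ω) 2 u * (2 * 2) := by
        have := (norm_nonneg _).trans hS
        gcongr
      _ = _ := by ring
  have h2 : B * ‖z‖ ^ 2 ≤ B * R ^ 2 := by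
    have := hR z hz
    gcongr
  rw [hGΩ x hx] at hle
  simp only [hG] at hle
  have : 0 ≤ B * ‖x‖ ^ 2 := by positivity
  linarith

/-- A bound for the Hessian in the interior extends to the closure. -/
lemma supDeriv_closure_le {u : E n → ℝ} (hu : IsCkBar 4 Ω u) {b : ℝ} (hb : 0 ≤ b)
    (h : ∀ x ∈ Ω, ‖iteratedFDeriv ℝ 2 u x‖ ≤ b) : supDeriv Ω (closure Ω) 2 u ≤ b := by
  have hk : ((2 : ℕ) : ℕ∞) ≤ 4 := by norm_num
  refine Real.sSup_le ?_ hb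
  rintro _ ⟨x, hx, rfl⟩
  have := mem_closure_iff_nhdsWithin_neBot.1 hx
  refine le_of_tendsto ((tendsto_extendFrom (hu.exists_limit 2 hk x hx)).norm) ?_
  filter_upwards [self_mem_nhdsWithin] with y hy using h y hy

end GlobalEstimate

end HessianEq

end

theorem theorem4p3 (n : ℕ) (hn : 2 ≤ n)
    (Ω : Set (HessianEq.E n)) (hΩ : HessianEq.IsSmoothBoundedDomain Ω)
    (Γ : Set (Fin n → ℝ)) (hΓ : HessianEq.IsAdmissibleCone Γ)
    (f : (Fin n → ℝ) → ℝ) (hf : HessianEq.StructureConditions Γ f)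
    (ψ : HessianEq.E n → ℝ) (hψ : HessianEq.IsCkBar ⊤ Ω ψ) (hψ_nonneg : ∀ x ∈ Ω, 0 ≤ ψ x)
    (φ : HessianEq.E n → ℝ)
    (ε₀ : ℝ) (hε₀ : 0 < ε₀) (A : ℝ) (M K : ℝ) :
    ∃ C : ℝ, 0 < C ∧
      ∀ γ : ℝ, 0 ≤ γ →
      ∀ usub : HessianEq.E n → ℝ, HessianEq.IsSubsolution Γ f Ω ψ φ γ usub →
        (∀ x ∈ closure Ω, ε₀ ≤ f (HessianEq.eig (HessianEq.augHess Ω γ usub x))) →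
        HessianEq.CkNorm 2 Ω usub ≤ K →
      ∀ η : ℝ → ℝ, HessianEq.IsCutoff ε₀ A η →
      ∀ ε : ℝ, 0 < ε → ε ≤ ε₀ / 2 →
      ∀ u : HessianEq.E n → ℝ, HessianEq.IsCkBar 4 Ω u →
        HessianEq.IsAdmissible Γ Ω γ u →
        HessianEq.SolvesApprox f Ω ψ φ η ε γ u →
        HessianEq.CkNorm 1 Ω u ≤ M →
        HessianEq.supDeriv Ω (closure Ω) 2 u ≤
            C * max γ 1 * (1 + HessianEq.supDeriv Ω (frontier Ω) 2 u) ∧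
          (γ ≤ 1 →
            HessianEq.supDeriv Ω (closure Ω) 2 u ≤
              C * (1 + HessianEq.supDeriv Ω (frontier Ω) 2 u)) := by
  open HessianEq in
  have : NeZero n := ⟨by omega⟩
  -- `t` and `δ` must be fixed before `γ`, and this condition does not involve `γ`. If it fails, no
  -- subsolution exists for any `γ ≥ 0` and the claim is vacuous.
  by_cases H : ∃ t : ℝ, 0 < t ∧ ∃ δ : ℝ, 0 < δ ∧ ∀ x ∈ Ω, max (ψ x) ε₀ + δ ≤ f fun _ => t
  swap
  · exact ⟨1, one_pos, fun γ hγ usub hsub hsub' => absurd (hsub.exists_const_ge hΩ hΓ hf hγ hsub') H⟩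
  obtain ⟨t, ht, δ, hδ, htδ⟩ := H
  have hψ2 : ContDiffOn ℝ 2 ψ Ω := hψ.contDiffOn_two le_top
  obtain ⟨N₁, hN₁0, hN₁⟩ := hψ.exists_norm_le hΩ.isOpen hΩ.isBounded (j := 1) le_top
  obtain ⟨N₂, hN₂0, hN₂⟩ := hψ.exists_norm_le hΩ.isOpen hΩ.isBounded (j := 2) le_top
  obtain ⟨R, hR⟩ := hΩ.isBounded.closure.exists_norm_le
  -- `-D` bounds `h_ξξ` from below; the factors 2 and 4 account for `‖ξ‖ ≤ 2`.
  set D : ℝ := N₂ * 4 + |A| / ε₀ * (N₁ * 2) ^ 2 + |A| * (N₂ * 4) with hD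
  have hD0 : 0 ≤ D := by positivity
  -- Chosen so that `∑ F_i ≥ δ / t` gives `2B ∑ F_i ≥ D + 1`, which exceeds what `h_ξξ ≥ -D`
  -- permits.
  set B : ℝ := (D + 1) * t / (2 * δ) with hB
  have hB0 : 0 ≤ B := by positivity
  set C : ℝ := n ^ 2 * (n + 1) * (4 + B * R ^ 2) with hC
  have hnpos : (0 : ℝ) < n := Nat.cast_pos.2 (NeZero.pos n)
  have hC0 : 0 < C := by positivity
  refine ⟨C, hC0, fun γ hγ usub hsub hsub' _ η hη ε hε hε' u hu hadm hsol _ => ?_⟩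
  have hk : (2 : ℕ∞) ≤ 4 := by norm_num
  have hu2 : ContDiffOn ℝ 2 u Ω := hu.contDiffOn_two hk
  set h : E n → ℝ := fun x => ψ x + ε * η (ψ x) with hh
  have hh2 : ContDiffOn ℝ 2 h Ω :=
    hψ2.add (contDiffOn_const.mul (hη.contDiffOn_comp hψ2 hψ_nonneg))
  have heqn : ∀ x ∈ Ω, f (eig (augHess Ω γ u x)) = h x := hsol.eqn
  have hmem : ∀ x ∈ Ω, eig (augHess Ω γ u x) ∈ Γ := fun x hx =>
    hf.mem_of_pos hΓ (hadm x hx)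
      (by rw [heqn x hx]; exact hη.add_mul_pos hε₀ hε (hψ_nonneg x hx))
  set S := supDeriv Ω (frontier Ω) 2 u with hS
  have hS0 : 0 ≤ S := Real.sSup_nonneg (by rintro _ ⟨x, _, rfl⟩; exact norm_nonneg _)
  have hpure : ∀ x ∈ Ω, ∀ ξ : E n, ‖ξ‖ ≤ 2 →
      dirDeriv ξ (dirDeriv ξ u) x ≤ 4 * S + B * R ^ 2 := fun x hx ξ hξ => by
    refine dirDeriv_sq_le_of_no_isMax hΩ hu hB0 hR hξ (fun z hz hmax => ?_) hx
    have h1 := dirDeriv_sq_le_of_isMax hΩ.isOpen hΓ hf hγ hu hh2 hmem heqn hB0 ξ hz hmax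
    have hP : |dirDeriv ξ ψ z| ≤ N₁ * 2 :=
      (abs_dirDeriv_le ξ z).trans (mul_le_mul (hN₁ z hz) hξ (norm_nonneg _) hN₁0)
    have hQ : |dirDeriv ξ (dirDeriv ξ ψ) z| ≤ N₂ * 4 :=
      (abs_dirDeriv_sq_le hΩ.isOpen hψ2 ξ hz).trans
        (mul_le_mul (hN₂ z hz) (by nlinarith [norm_nonneg ξ]) (by positivity) hN₂0)
    have h2 := hη.le_dirDeriv_sq hΩ.isOpen hψ2 hψ_nonneg hε₀ hε hε' hz hP hQ
    have h3 := hf.sub_le_mul_sum hΓ (hmem z hz) ht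
    rw [heqn z hz] at h3
    have h4 : h z ≤ max (ψ z) ε₀ := hη.add_mul_le hε hε' (hψ_nonneg z hz)
    set F := ∑ i, fderiv ℝ f (eig (augHess Ω γ u z)) (Pi.single i 1)
    have h5 : δ ≤ t * F := by linarith [htδ z hz]
    have h6 : D + 1 ≤ 2 * B * F := by
      have e : 2 * B * F = (D + 1) * (t * F / δ) := by rw [hB]; field_simp
      rw [e]
      exact le_mul_of_one_le_right (by positivity) ((one_le_div hδ).2 h5)
    have h7 := h2.trans h1
    rw [← hD] at h7
    linarith
  -- The eigenvalues sum to `(1 + γ n) Δu`, with a positive coefficient.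
  have hlap : ∀ x ∈ Ω, 0 ≤ lap u x := fun x hx => by
    have h1 := hf.sum_nonneg hΓ (hmem x hx)
    rw [sum_eig_augHess hu hk hΩ.isOpen hx] at h1
    exact nonneg_of_mul_nonneg_right h1 (by positivity)
  have hfinal : supDeriv Ω (closure Ω) 2 u ≤ C * (1 + S) := by
    have h1 : supDeriv Ω (closure Ω) 2 u ≤ n ^ 2 * (n + 1) * (4 * S + B * R ^ 2) :=
      supDeriv_closure_le hu (by positivity) fun x hx =>
        norm_iteratedFDeriv_two_le hΩ.isOpen hu2 hx (by positivity) (hpure x hx) (hlap x hx)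
    refine h1.trans ?_
    rw [hC, mul_assoc _ (4 + B * R ^ 2)]
    refine mul_le_mul_of_nonneg_left ?_ (by positivity)
    have : 0 ≤ B * R ^ 2 * S := by positivity
    linarith
  refine ⟨hfinal.trans ?_, fun _ => hfinal⟩
  refine mul_le_mul_of_nonneg_right ?_ (by positivity)
  exact le_mul_of_one_le_right hC0.le (le_max_right _ _)
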